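/- Let $H$ be Hofstadter's $H$-sequence, defined by $H(0)=0$ and $H(i)=i-H(H(H(i-1)))$ for $i\ge 1$. Let $\mathbf{s}=(s_i)_{i\ge 0}$ be the sequence A202340, where $s_i$ is the number of integers $n\ge 0$ with $H(n)=i$. A finite word $w$ of length $n \geq 1$ has period $p$, for $1\le p\le n$, if its prefix of length $n-p$ equals its suffix of length $n-p$; the exponent of $w$ is $n$ divided by the smallest period of $w$; the critical exponent of an infinite word is the supremum of the exponents of its nonempty finite factors (blocks of consecutive terms). Then the critical exponent of $\mathbf{s}$ is $$\frac{\alpha^2+\alpha+5}{3} \doteq 2.871156755860518460227649,$$ where $\alpha \doteq 1.465571231876768026656731$ is the unique real root of $X^3=X^2+1$. -/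

import Mathlib

/-- Hofstadter's `H`, together with the bound `H n ≤ n` that makes the nested recursion
`H (n + 1) = n + 1 - H (H (H n))` well-founded. -/
def hofstadterHAux : (n : ℕ) → {m : ℕ // m ≤ n}
  | 0 => ⟨0, le_rfl⟩
  | n + 1 =>
    let a := hofstadterHAux n
    have _ha : a.1 < n + 1 := Nat.lt_succ_of_le a.2
    let b := hofstadterHAux a.1
    have _hb : b.1 < n + 1 := Nat.lt_succ_of_le (b.2.trans a.2)
    let c := hofstadterHAux b.1
    ⟨n + 1 - c.1, Nat.sub_le _ _⟩
termination_by n => n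
decreasing_by
  · exact Nat.lt_succ_self n
  · exact _ha
  · exact _hb

/-- Hofstadter's `H`-sequence: `H 0 = 0` and `H i = i - H (H (H (i - 1)))` for `i ≥ 1`. -/
def hofstadterH (n : ℕ) : ℕ := (hofstadterHAux n).1

theorem hofstadterH_le (n : ℕ) : hofstadterH n ≤ n := (hofstadterHAux n).2

theorem hofstadterH_zero : hofstadterH 0 = 0 := by
  simp [hofstadterH, hofstadterHAux]

/-- The defining recurrence, written without subtraction (so nothing is truncated). -/
theorem hofstadterH_succ (n : ℕ) :
    hofstadterH (n + 1) + hofstadterH (hofstadterH (hofstadterH n)) = n + 1 := by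
  have h1 := hofstadterH_le n
  have h2 := hofstadterH_le (hofstadterH n)
  have h3 := hofstadterH_le (hofstadterH (hofstadterH n))
  have h : hofstadterH (n + 1) = n + 1 - hofstadterH (hofstadterH (hofstadterH n)) := by
    simp only [hofstadterH]
    rw [hofstadterHAux]
  omega

theorem hofstadterH_step (n : ℕ) :
    hofstadterH (n + 1) = hofstadterH n ∨ hofstadterH (n + 1) = hofstadterH n + 1 := by
  induction n using Nat.strong_induction_on with
  | _ n ih =>
    rcases n with _ | n
    · have h := hofstadterH_succ 0
      simp only [hofstadterH_zero] at h ⊢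
      omega
    · have e1 := hofstadterH_succ n
      have e2 := hofstadterH_succ (n + 1)
      have b1 := hofstadterH_le n
      have b2 := hofstadterH_le (hofstadterH n)
      have i1 := ih n (by omega)
      have i2 := ih (hofstadterH n) (by omega)
      have i3 := ih (hofstadterH (hofstadterH n)) (by omega)
      rcases i1 with i1 | i1
      · rw [i1] at e1 e2 ⊢
        omega
      · rw [i1] at e2
        rcases i2 with i2 | i2
        · rw [i2] at e2
          omega
        · rw [i2] at e2
          omega

/-- Every value of `H` is taken only finitely often, so counting with `Set.ncard` is meaningful. -/
theorem hofstadterH_fiber_finite (i : ℕ) : {n : ℕ | hofstadterH n = i}.Finite := by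
  refine (Set.finite_Iic (2 * i)).subset ?_
  intro n hn
  simp only [Set.mem_ofPred_eq, Set.mem_Iic] at hn ⊢
  rcases n with _ | n
  · omega
  · have h1 := hofstadterH_succ n
    have h2 := hofstadterH_le (hofstadterH n)
    have h3 := hofstadterH_le (hofstadterH (hofstadterH n))
    have h4 := hofstadterH_step n
    omega

/-- The sequence A202340: its `i`-th term (`i ≥ 0`) is the number of `n ≥ 0` with `H n = i`. -/
noncomputable def A202340 (i : ℕ) : ℕ := {n : ℕ | hofstadterH n = i}.ncard

/-- The finite word `u` has period `p`: `1 ≤ p ≤ |u|` and `u[j] = u[j + p]` whenever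
`j + p < |u|` (the prefix of `u` of length `|u| - p` equals the suffix of that length). -/
def WordHasPeriod {A : Type*} (u : List A) (p : ℕ) : Prop :=
  1 ≤ p ∧ p ≤ u.length ∧ u.HasPeriod p

/-- The smallest period of a finite word (a nonempty word `u` always has the period `|u|`). -/
noncomputable def wordPeriod {A : Type*} (u : List A) : ℕ := sInf {p : ℕ | WordHasPeriod u p}

/-- The exponent of a finite nonempty word: its length divided by its smallest period. -/
noncomputable def wordExponent {A : Type*} (u : List A) : ℝ :=
  (u.length : ℝ) / (wordPeriod u : ℝ)

/-- The factor `w i, w (i + 1), …, w (i + n - 1)` of the infinite word `w`. -/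
def wordFactor {A : Type*} (w : ℕ → A) (i n : ℕ) : List A :=
  (List.range n).map fun k => w (i + k)

/-- `β` is the critical exponent of the infinite word `w`: the supremum of the exponents of the
nonempty factors of `w`. -/
def IsCriticalExponent {A : Type*} (w : ℕ → A) (β : ℝ) : Prop :=
  IsLUB {e : ℝ | ∃ i n : ℕ, 1 ≤ n ∧ e = wordExponent (wordFactor w i n)} β

/-! The jumps of `H` are coded by the fixed point `narayanaWord` of `0 ↦ 01`, `1 ↦ 2`, `2 ↦ 0`, and,
up to a shift by one, A202340 lists the lengths of the images of its letters (`blockStart_spec`,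
`A202340_succ`). Repetitions can therefore be studied in `narayanaWord`.

Two equal factors at distance `p` are desubstituted until they come from different letters
(`exists_iterate_blockStart`). Images of different letters have an explicit longest common prefix,
of length `narayanaSum k` (`lcpAt_narayanaSum`), while `p` is at least the length of an image, hence
at least `narayana k`. Passing to A202340 lengthens the overlap by at most one letter, so apart from
tiny cases exponents are at most `1 + (narayanaSum k + 1) / narayana k`. Iterated images of the
factor `20` give exponents at least `1 + narayanaSum k / narayana k`.

Finally `narayanaSum k` is `(α ^ 2 + α + 2) / 3 * narayana k` up to a bounded error, because the
other two roots of `X ^ 3 = X ^ 2 + 1` lie inside the unit disc. The sign of this error absorbs the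
extra letter for `k ≥ 1`, so the supremum is exactly `1 + (α ^ 2 + α + 2) / 3`. -/

/-- `HJump n` says that Hofstadter's `H` increases from `n` to `n + 1`. -/
def HJump (n : ℕ) : Prop := hofstadterH (n + 1) = hofstadterH n + 1

theorem HJump.not_iff {n : ℕ} : ¬ HJump n ↔ hofstadterH (n + 1) = hofstadterH n := by
  have := hofstadterH_step n
  unfold HJump
  omega

theorem hofstadterH_mono : Monotone hofstadterH :=
  monotone_nat_of_le_succ fun n => by have := hofstadterH_step n; omega

theorem hofstadterH_one : hofstadterH 1 = 1 := by
  have := hofstadterH_succ 0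
  simpa [hofstadterH_zero] using this

theorem HJump.zero : HJump 0 := by simp [HJump, hofstadterH_zero, hofstadterH_one]

/-- Where `H` is flat, the iterate subtracted in the recurrence repeats, so the next value must
grow. -/
theorem HJump.succ_of_not {n : ℕ} (h : ¬ HJump n) : HJump (n + 1) := by
  rw [HJump.not_iff] at h
  have h1 := hofstadterH_succ n
  have h2 := hofstadterH_succ (n + 1)
  rw [h] at h2
  unfold HJump
  omega

/-- After a jump, the next step is flat exactly when the third iterate of `H` jumps. -/
theorem HJump.not_succ_iff {n : ℕ} (h : HJump n) :
    ¬ HJump (n + 1) ↔ HJump (hofstadterH n) ∧ HJump (hofstadterH (hofstadterH n)) := by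
  have h1 := hofstadterH_succ n
  have h2 := hofstadterH_succ (n + 1)
  have h' := h
  unfold HJump at h
  rw [h] at h2
  by_cases a : HJump (hofstadterH n)
  · have a' := a
    unfold HJump at a
    rw [a] at h2
    by_cases b : HJump (hofstadterH (hofstadterH n))
    · have b' := b
      unfold HJump at b
      simp only [a', b', and_self, iff_true, HJump.not_iff]
      omega
    · simp only [b, and_false, iff_false, not_not]
      rw [HJump.not_iff] at b
      unfold HJump
      omega
  · simp only [a, false_and, iff_false, not_not]
    rw [HJump.not_iff] at a
    rw [a] at h2
    unfold HJump
    omega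

/-- Two jumps at the same level of `H` coincide. -/
theorem HJump.unique {m n : ℕ} (hm : HJump m) (hn : HJump n)
    (h : hofstadterH m = hofstadterH n) : m = n := by
  unfold HJump at hm hn
  rcases lt_trichotomy m n with l | l | l
  · have := hofstadterH_mono (show m + 1 ≤ n from l)
    omega
  · exact l
  · have := hofstadterH_mono (show n + 1 ≤ m from l)
    omega

/-! ### The Narayana word and its morphism -/

open Classical in
/-- The fixed point of the Narayana morphism `0 ↦ 01`, `1 ↦ 2`, `2 ↦ 0`, read off from the jumps
of `H`. -/
noncomputable def narayanaWord (n : ℕ) : ℕ :=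
  if HJump n then (if HJump (hofstadterH n) then 0 else 2) else 1

theorem narayanaWord_eq_one {n : ℕ} : narayanaWord n = 1 ↔ ¬ HJump n := by
  unfold narayanaWord
  split_ifs <;> simp_all

theorem narayanaWord_eq_zero {n : ℕ} :
    narayanaWord n = 0 ↔ HJump n ∧ HJump (hofstadterH n) := by
  unfold narayanaWord
  split_ifs <;> simp_all

theorem narayanaWord_cases (n : ℕ) :
    narayanaWord n = 0 ∨ narayanaWord n = 1 ∨ narayanaWord n = 2 := by
  unfold narayanaWord
  split_ifs <;> simp

theorem narayanaWord_zero : narayanaWord 0 = 0 := by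
  rw [narayanaWord_eq_zero, hofstadterH_zero]
  exact ⟨HJump.zero, HJump.zero⟩

/-- The length of the image of the prefix of length `i` of `narayanaWord` under the Narayana
morphism, that is, the starting position of the image of the letter at `i`. -/
noncomputable def blockStart : ℕ → ℕ
  | 0 => 0
  | i + 1 => blockStart i + if narayanaWord i = 0 then 2 else 1

theorem blockStart_zero : blockStart 0 = 0 := rfl

theorem blockStart_succ_of_eq {i : ℕ} (h : narayanaWord i = 0) :
    blockStart (i + 1) = blockStart i + 2 := by simp [blockStart, h]

theorem blockStart_succ_of_ne {i : ℕ} (h : narayanaWord i ≠ 0) :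
    blockStart (i + 1) = blockStart i + 1 := by simp [blockStart, h]

/-- By `HJump.not_succ_iff`, the gap after the jump at level `i` is 2 exactly when the letter at `i`
is `0`, which is the block length of the morphism. -/
theorem blockStart_spec (i : ℕ) :
    hofstadterH (blockStart i) = i ∧ HJump (blockStart i) := by
  induction i with
  | zero => exact ⟨hofstadterH_zero, HJump.zero⟩
  | succ i ih =>
    obtain ⟨h1, h2⟩ := ih
    have h3 := h2.not_succ_iff
    rw [h1, ← narayanaWord_eq_zero] at h3
    have h4 : hofstadterH (blockStart i + 1) = i + 1 := by rw [h2, h1]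
    by_cases h : narayanaWord i = 0
    · rw [blockStart_succ_of_eq h]
      have h5 := h3.2 h
      exact ⟨(HJump.not_iff.1 h5).trans h4, HJump.succ_of_not h5⟩
    · rw [blockStart_succ_of_ne h]
      exact ⟨h4, not_not.1 (mt h3.1 h)⟩

theorem blockStart_strictMono : StrictMono blockStart :=
  strictMono_nat_of_lt_succ fun i => by
    simp only [blockStart]
    split_ifs <;> omega

theorem hofstadterH_eq_succ_iff {n i : ℕ} :
    hofstadterH n = i + 1 ↔ blockStart i < n ∧ n ≤ blockStart (i + 1) := by
  obtain ⟨a1, a2⟩ := blockStart_spec i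
  obtain ⟨b1, b2⟩ := blockStart_spec (i + 1)
  unfold HJump at a2 b2
  constructor
  · intro h
    constructor
    · by_contra! hc
      have := hofstadterH_mono hc
      omega
    · by_contra! hc
      have := hofstadterH_mono (show blockStart (i + 1) + 1 ≤ n from hc)
      omega
  · rintro ⟨h1, h2⟩
    have := hofstadterH_mono (show blockStart i + 1 ≤ n from h1)
    have := hofstadterH_mono h2
    omega

theorem A202340_zero : A202340 0 = 1 := by
  have : {n : ℕ | hofstadterH n = 0} = {0} := by
    ext n
    simp only [Set.mem_ofPred_eq, Set.mem_singleton_iff]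
    constructor
    · intro h
      by_contra hn
      have := hofstadterH_mono (Nat.one_le_iff_ne_zero.2 hn)
      rw [hofstadterH_one] at this
      omega
    · rintro rfl
      exact hofstadterH_zero
  rw [A202340, this, Set.ncard_singleton]

/-- Apart from its first term, A202340 records the block lengths of the Narayana morphism. -/
theorem A202340_succ (i : ℕ) : A202340 (i + 1) = if narayanaWord i = 0 then 2 else 1 := by
  have : {n : ℕ | hofstadterH n = i + 1} = ↑(Finset.Ioc (blockStart i) (blockStart (i + 1))) := by
    ext n
    simp [hofstadterH_eq_succ_iff]
  rw [A202340, this, Set.ncard_coe_finset, Nat.card_Ioc]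
  simp [blockStart]

theorem narayanaWord_blockStart_eq_two {i : ℕ} (h : narayanaWord i = 1) :
    narayanaWord (blockStart i) = 2 := by
  rw [narayanaWord_eq_one] at h
  simp [narayanaWord, blockStart_spec, h]

theorem narayanaWord_blockStart_eq_zero {i : ℕ} (h : narayanaWord i ≠ 1) :
    narayanaWord (blockStart i) = 0 := by
  rw [Ne, narayanaWord_eq_one, not_not] at h
  simp [narayanaWord, blockStart_spec, h]

theorem narayanaWord_blockStart_add_one {i : ℕ} (h : narayanaWord i = 0) :
    narayanaWord (blockStart i + 1) = 1 := by
  obtain ⟨h1, h2⟩ := blockStart_spec i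
  rw [narayanaWord_eq_one, h2.not_succ_iff, h1, ← narayanaWord_eq_zero]
  exact h

theorem exists_blockStart_of_ne_one {n : ℕ} (h : narayanaWord n ≠ 1) : ∃ i, n = blockStart i := by
  rw [Ne, narayanaWord_eq_one, not_not] at h
  obtain ⟨h1, h2⟩ := blockStart_spec (hofstadterH n)
  exact ⟨_, h.unique h2 h1.symm⟩

theorem narayanaWord_pred_of_eq_one {n : ℕ} (h : narayanaWord (n + 1) = 1) :
    narayanaWord n = 0 := by
  have h' := narayanaWord_eq_one.1 h
  have hn : HJump n := by
    by_contra hn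
    exact h' (HJump.succ_of_not hn)
  exact narayanaWord_eq_zero.2 ⟨hn, (hn.not_succ_iff.1 h').1⟩

/-- A `2` is the image of a `1`, which is not followed by another `1`; hence the next block opens
with `0`. -/
theorem narayanaWord_succ_of_eq_two {n : ℕ} (h : narayanaWord n = 2) :
    narayanaWord (n + 1) = 0 := by
  obtain ⟨i, rfl⟩ := exists_blockStart_of_ne_one (n := n) (by omega)
  have hi : narayanaWord i = 1 := by
    by_contra hi
    have := narayanaWord_blockStart_eq_zero hi
    omega
  have h1 : narayanaWord (i + 1) ≠ 1 := fun h1 => by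
    have := narayanaWord_pred_of_eq_one h1
    omega
  have h2 := blockStart_succ_of_ne (i := i) (by omega)
  rw [← h2]
  exact narayanaWord_blockStart_eq_zero h1

theorem narayanaWord_pred_of_eq_two {n : ℕ} (h : narayanaWord (n + 1) = 2) :
    narayanaWord n = 1 := by
  obtain ⟨i, hi⟩ := exists_blockStart_of_ne_one (n := n + 1) (by omega)
  rw [hi] at h
  have h1 : narayanaWord i = 1 := by
    by_contra h1
    have := narayanaWord_blockStart_eq_zero h1
    omega
  rcases i with _ | i
  · rw [narayanaWord_zero] at h1
    omega
  have h0 := narayanaWord_pred_of_eq_one h1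
  have h2 := narayanaWord_blockStart_add_one h0
  rw [blockStart_succ_of_eq h0] at hi
  rw [show n = blockStart i + 1 by omega]
  exact h2

/-! ### Images of equal factors -/

/-- The words `narayanaWord` starting at `i` and at `j` agree on their first `m` letters. -/
def AgreeAt (i j m : ℕ) : Prop := ∀ t < m, narayanaWord (i + t) = narayanaWord (j + t)

theorem AgreeAt.append {i j m l : ℕ} (h : AgreeAt i j m) (h' : AgreeAt (i + m) (j + m) l) :
    AgreeAt i j (m + l) := by
  intro t ht
  rcases lt_or_ge t m with h1 | h1
  · exact h t h1
  · have := h' (t - m) (by omega)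
    rwa [show i + m + (t - m) = i + t by omega, show j + m + (t - m) = j + t by omega] at this

theorem AgreeAt.mono {i j m l : ℕ} (h : AgreeAt i j m) (hl : l ≤ m) : AgreeAt i j l :=
  fun t ht => h t (ht.trans_le hl)

theorem agreeAt_one {i j : ℕ} : AgreeAt i j 1 ↔ narayanaWord i = narayanaWord j := by
  simp [AgreeAt]

theorem agreeAt_zero (i j : ℕ) : AgreeAt i j 0 := by simp [AgreeAt]

/-- The Narayana morphism maps equal factors to equal factors. -/
theorem AgreeAt.image {u v r : ℕ} (h : AgreeAt u v r) :
    ∃ f, blockStart (u + r) = blockStart u + f ∧ blockStart (v + r) = blockStart v + f ∧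
      AgreeAt (blockStart u) (blockStart v) f := by
  induction r with
  | zero => exact ⟨0, by simp, by simp, agreeAt_zero _ _⟩
  | succ r ih =>
    obtain ⟨f, h1, h2, h3⟩ := ih (h.mono r.le_succ)
    have h4 := h r r.lt_succ_self
    have h5 : AgreeAt (blockStart u + f) (blockStart v + f) 1 := by
      rw [agreeAt_one, ← h1, ← h2]
      by_cases c : narayanaWord (u + r) = 1
      · rw [narayanaWord_blockStart_eq_two c, narayanaWord_blockStart_eq_two (h4 ▸ c)]
      · rw [narayanaWord_blockStart_eq_zero c, narayanaWord_blockStart_eq_zero (h4 ▸ c)]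
    by_cases c : narayanaWord (u + r) = 0
    · refine ⟨f + 2, ?_, ?_, h3.append ?_⟩
      · rw [← add_assoc u, blockStart_succ_of_eq c, h1, add_assoc]
      · rw [← add_assoc v, blockStart_succ_of_eq (h4 ▸ c), h2, add_assoc]
      · refine h5.append (agreeAt_one.2 ?_)
        rw [← h1, ← h2, narayanaWord_blockStart_add_one c,
          narayanaWord_blockStart_add_one (h4 ▸ c)]
    · refine ⟨f + 1, ?_, ?_, h3.append h5⟩
      · rw [← add_assoc u, blockStart_succ_of_ne c, h1, add_assoc]
      · rw [← add_assoc v, blockStart_succ_of_ne (h4 ▸ c), h2, add_assoc]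

theorem AgreeAt.iterate_image {u v r : ℕ} (h : AgreeAt u v r) (k : ℕ) :
    ∃ f, blockStart^[k] (u + r) = blockStart^[k] u + f ∧
      blockStart^[k] (v + r) = blockStart^[k] v + f ∧
      AgreeAt (blockStart^[k] u) (blockStart^[k] v) f := by
  induction k with
  | zero => exact ⟨r, rfl, rfl, h⟩
  | succ k ih =>
    obtain ⟨f, h1, h2, h3⟩ := ih
    obtain ⟨g, h4, h5, h6⟩ := h3.image
    simp only [Function.iterate_succ_apply', h1, h2]
    exact ⟨g, h4, h5, h6⟩

/-! ### Lengths of iterated images -/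

/-- The Narayana numbers `1, 2, 3, 4, 6, 9, 13, …`, the lengths of the iterated images of the
letter `0`. -/
noncomputable def narayana (k : ℕ) : ℕ := blockStart^[k] 1

theorem iterate_blockStart_zero (k : ℕ) : blockStart^[k] 0 = 0 := by
  induction k with
  | zero => rfl
  | succ k ih => rw [Function.iterate_succ_apply, blockStart_zero, ih]

theorem iterate_blockStart_succ_of_eq_zero {a : ℕ} (h : narayanaWord a = 0) (k : ℕ) :
    blockStart^[k] (a + 1) = blockStart^[k] a + narayana k := by
  obtain ⟨f, h1, h2, -⟩ :=
    (agreeAt_one.2 (h.trans narayanaWord_zero.symm) : AgreeAt a 0 1).iterate_image k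
  rw [iterate_blockStart_zero, zero_add, zero_add] at h2
  rw [h1, narayana, h2]

theorem iterate_blockStart_succ_of_eq_two {a : ℕ} (h : narayanaWord a = 2) (k : ℕ) :
    blockStart^[k + 1] (a + 1) = blockStart^[k + 1] a + narayana k := by
  rw [Function.iterate_succ_apply, Function.iterate_succ_apply,
    blockStart_succ_of_ne (by omega : narayanaWord a ≠ 0)]
  exact iterate_blockStart_succ_of_eq_zero (narayanaWord_blockStart_eq_zero (by omega)) k

theorem iterate_blockStart_succ_of_eq_one {a : ℕ} (h : narayanaWord a = 1) (k : ℕ) :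
    blockStart^[k + 2] (a + 1) = blockStart^[k + 2] a + narayana k := by
  rw [Function.iterate_succ_apply, Function.iterate_succ_apply blockStart (k + 1) a,
    blockStart_succ_of_ne (by omega : narayanaWord a ≠ 0)]
  exact iterate_blockStart_succ_of_eq_two (narayanaWord_blockStart_eq_two h) k

theorem narayanaWord_one : narayanaWord 1 = 1 :=
  narayanaWord_blockStart_add_one narayanaWord_zero

theorem blockStart_one : blockStart 1 = 2 := blockStart_succ_of_eq narayanaWord_zero

theorem blockStart_two : blockStart 2 = 3 := by
  rw [blockStart_succ_of_ne (by rw [narayanaWord_one]; omega), blockStart_one]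

theorem narayanaWord_two : narayanaWord 2 = 2 := by
  have h := narayanaWord_blockStart_eq_two narayanaWord_one
  rwa [blockStart_one] at h

theorem narayanaWord_three : narayanaWord 3 = 0 := narayanaWord_succ_of_eq_two narayanaWord_two

theorem blockStart_three : blockStart 3 = 4 := by
  rw [blockStart_succ_of_ne (by rw [narayanaWord_two]; omega), blockStart_two]

theorem narayana_zero : narayana 0 = 1 := rfl

theorem narayana_one : narayana 1 = 2 := blockStart_one

theorem narayana_two : narayana 2 = 3 := by
  simp [narayana, blockStart_one, blockStart_two]

theorem narayana_add_three (k : ℕ) : narayana (k + 3) = narayana (k + 2) + narayana k := by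
  have h := iterate_blockStart_succ_of_eq_zero narayanaWord_three k
  have h3 : narayana (k + 2) = blockStart^[k] 3 := by
    simp [narayana, Function.iterate_succ_apply, blockStart_one, blockStart_two]
  have h4 : narayana (k + 3) = blockStart^[k] (3 + 1) := by
    simp [narayana, Function.iterate_succ_apply, blockStart_one, blockStart_two, blockStart_three]
  rw [h3, h4, h]

theorem narayana_pos (k : ℕ) : 0 < narayana k := by
  have h := (blockStart_strictMono.iterate k) zero_lt_one
  rwa [iterate_blockStart_zero] at h

theorem narayana_strictMono : StrictMono narayana :=
  strictMono_nat_of_lt_succ fun k => by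
    unfold narayana
    rw [Function.iterate_succ_apply, blockStart_one]
    exact (blockStart_strictMono.iterate k) (by omega)

/-- The sums `narayana k + narayana (k - 2) + narayana (k - 4) + ⋯`. -/
noncomputable def narayanaSum : ℕ → ℕ
  | 0 => 1
  | 1 => 2
  | k + 2 => narayana (k + 2) + narayanaSum k


/-! ### Longest common prefixes and desubstitution -/

/-- The longest common prefix of `narayanaWord` at `i` and at `j` has length `m`. -/
def LcpAt (i j m : ℕ) : Prop := AgreeAt i j m ∧ narayanaWord (i + m) ≠ narayanaWord (j + m)

theorem LcpAt.symm {i j m : ℕ} (h : LcpAt i j m) : LcpAt j i m :=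
  ⟨fun t ht => (h.1 t ht).symm, h.2.symm⟩

theorem AgreeAt.append_lcpAt {i j m l : ℕ} (h : AgreeAt i j m) (h' : LcpAt (i + m) (j + m) l) :
    LcpAt i j (m + l) :=
  ⟨h.append h'.1, by simpa only [add_assoc] using h'.2⟩

theorem LcpAt.le {i j m l : ℕ} (h : LcpAt i j m) (h' : AgreeAt i j l) : l ≤ m := by
  by_contra! hc
  exact h.2 (h' m hc)

theorem agreeAt_iterate_blockStart {a b : ℕ} (ha : narayanaWord a = 0) (hb : narayanaWord b = 0)
    (k : ℕ) : AgreeAt (blockStart^[k] a) (blockStart^[k] b) (narayana k) := by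
  obtain ⟨f, h1, -, h3⟩ := (agreeAt_one.2 (ha.trans hb.symm)).iterate_image k
  rw [iterate_blockStart_succ_of_eq_zero ha] at h1
  rwa [Nat.add_left_cancel h1]

/-- If the letters at `a` and `b` are `2` and `0`, then the longest common prefix of
`narayanaWord` at the images of `a` and `b` under `k + 1` steps has length `narayanaSum k`. -/
theorem lcpAt_narayanaSum (k : ℕ) {a b : ℕ} (ha : narayanaWord a = 2) (hb : narayanaWord b = 0) :
    LcpAt (blockStart^[k + 1] a) (blockStart^[k + 1] b) (narayanaSum k) := by
  induction k using Nat.strong_induction_on generalizing a b with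
  | _ k ih =>
    have a0 := narayanaWord_blockStart_eq_zero (i := a) (by omega)
    have b0 := narayanaWord_blockStart_eq_zero (i := b) (by omega)
    have a1 : narayanaWord (blockStart a + 1) = 0 := by
      rw [← blockStart_succ_of_ne (by omega)]
      refine narayanaWord_blockStart_eq_zero ?_
      rw [narayanaWord_succ_of_eq_two ha]
      omega
    have b1 := narayanaWord_blockStart_add_one hb
    have a2 := narayanaWord_blockStart_eq_zero (i := blockStart a + 1) (by omega)
    have b2 := narayanaWord_blockStart_eq_two b1
    have key := agreeAt_iterate_blockStart a0 b0 k
    rw [Function.iterate_succ_apply, Function.iterate_succ_apply]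
    have ea := iterate_blockStart_succ_of_eq_zero a0 k
    have eb := iterate_blockStart_succ_of_eq_zero b0 k
    -- One step turns the two positions into `00` and `01`. The common `0` contributes `narayana k`;
    -- then `0` faces `1`, and one step later `0` faces `2`, the same situation with the roles
    -- exchanged.
    suffices h : ∃ l, narayanaSum k = narayana k + l ∧
        LcpAt (blockStart^[k] (blockStart a + 1)) (blockStart^[k] (blockStart b + 1)) l by
      obtain ⟨l, hl, h⟩ := h
      rw [hl]
      refine key.append_lcpAt ?_
      rwa [← ea, ← eb]
    match k with
    | 0 => exact ⟨0, rfl, agreeAt_zero _ _, by simp [a1, b1]⟩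
    | 1 => exact ⟨0, narayana_one.symm, agreeAt_zero _ _, by simp [a2, b2]⟩
    | k + 2 =>
      refine ⟨narayanaSum k, rfl, ?_⟩
      rw [Function.iterate_succ_apply, Function.iterate_succ_apply blockStart (k + 1)]
      exact (ih k (by omega) b2 a2).symm

/-- Equal factors at different positions come from iterated images of different letters. -/
theorem exists_iterate_blockStart {i j : ℕ} (hij : i < j) :
    ∃ k a b r, narayanaWord a ≠ narayanaWord b ∧ i = blockStart^[k] a + r ∧
      j = blockStart^[k] b + r ∧ AgreeAt (blockStart^[k] a) (blockStart^[k] b) r := by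
  induction j using Nat.strong_induction_on generalizing i with
  | _ j ih =>
    by_cases hne : narayanaWord i = narayanaWord j
    · by_cases h1 : narayanaWord i = 1
      · rcases i with _ | i
        · rw [narayanaWord_zero] at h1
          omega
        obtain ⟨j, rfl⟩ : ∃ l, j = l + 1 := ⟨j - 1, by omega⟩
        obtain ⟨k, a, b, r, h, rfl, rfl, h'⟩ := ih j (by omega) (by omega : i < j)
        refine ⟨k, a, b, r + 1, h, by omega, by omega, h'.append (agreeAt_one.2 ?_)⟩
        rw [narayanaWord_pred_of_eq_one h1, narayanaWord_pred_of_eq_one (hne ▸ h1)]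
      · obtain ⟨i', rfl⟩ := exists_blockStart_of_ne_one h1
        obtain ⟨j', rfl⟩ := exists_blockStart_of_ne_one (hne ▸ h1)
        have hij' : i' < j' := blockStart_strictMono.lt_iff_lt.1 hij
        have hj : j' < blockStart j' := by
          obtain ⟨j, rfl⟩ : ∃ l, j' = l + 1 := ⟨j' - 1, by omega⟩
          clear ih hne hij hij'
          induction j with
          | zero => rw [blockStart_one]; omega
          | succ j ih =>
            have := blockStart_strictMono (show j + 1 < j + 1 + 1 by omega)
            omega
        obtain ⟨k, a, b, r, h, rfl, rfl, h'⟩ := ih j' hj hij'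
        obtain ⟨f, h2, h3, h4⟩ := h'.image
        exact ⟨k + 1, a, b, f, h, by rw [h2, Function.iterate_succ_apply'],
          by rw [h3, Function.iterate_succ_apply'], by
            rwa [Function.iterate_succ_apply', Function.iterate_succ_apply']⟩
    · exact ⟨0, i, j, 0, hne, rfl, rfl, agreeAt_zero _ _⟩

theorem narayana_le_of_ne_one {a : ℕ} (h : narayanaWord a ≠ 1) (k : ℕ) :
    blockStart^[k + 1] a + narayana k ≤ blockStart^[k + 1] (a + 1) := by
  rcases narayanaWord_cases a with h0 | h0 | h0
  · rw [iterate_blockStart_succ_of_eq_zero h0]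
    have := narayana_strictMono (Nat.lt_add_one k)
    omega
  · exact absurd h0 h
  · rw [iterate_blockStart_succ_of_eq_two h0]

theorem narayana_le (a k : ℕ) :
    blockStart^[k + 2] a + narayana k ≤ blockStart^[k + 2] (a + 1) := by
  by_cases h : narayanaWord a = 1
  · rw [iterate_blockStart_succ_of_eq_one h]
  · have : blockStart^[k + 2] a + narayana (k + 1) ≤ blockStart^[k + 2] (a + 1) :=
      narayana_le_of_ne_one h (k + 1)
    have := narayana_strictMono (Nat.lt_add_one k)
    omega

/-- A nonempty factor of `narayanaWord` that reoccurs `j - i` positions later is bounded in terms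
of `j - i`. -/
theorem AgreeAt.exists_le_narayanaSum {i j m : ℕ} (hij : i < j) (h : AgreeAt i j m) :
    m = 0 ∨ ∃ k, m ≤ narayanaSum k ∧ narayana k ≤ j - i := by
  obtain ⟨k, a, b, r, hne, rfl, rfl, hr⟩ := exists_iterate_blockStart hij
  have hab : a < b := (blockStart_strictMono.iterate k).lt_iff_lt.1 (by omega)
  have hmono : blockStart^[k] (a + 1) ≤ blockStart^[k] b :=
    (blockStart_strictMono.iterate k).monotone hab
  have hrm := hr.append h
  rcases k with _ | k
  · left
    have : LcpAt (blockStart^[0] a) (blockStart^[0] b) 0 := ⟨agreeAt_zero _ _, by simpa using hne⟩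
    have := this.le hrm
    omega
  · by_cases h1 : narayanaWord a ≠ 1 ∧ narayanaWord b ≠ 1
    · right
      refine ⟨k, ?_, ?_⟩
      · have : LcpAt (blockStart^[k + 1] a) (blockStart^[k + 1] b) (narayanaSum k) := by
          have ha := narayanaWord_cases a
          have hb := narayanaWord_cases b
          rcases (by omega : (narayanaWord a = 2 ∧ narayanaWord b = 0) ∨
            (narayanaWord b = 2 ∧ narayanaWord a = 0)) with ⟨h2, h0⟩ | ⟨h2, h0⟩
          · exact lcpAt_narayanaSum k h2 h0
          · exact (lcpAt_narayanaSum k h2 h0).symm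
        have := this.le hrm
        omega
      · have := narayana_le_of_ne_one h1.1 k
        omega
    -- If one letter is `1`, a further step produces `2` against `0`, at the cost of one level.
    · have key : (narayanaWord (blockStart a) = 2 ∧ narayanaWord (blockStart b) = 0) ∨
          (narayanaWord (blockStart b) = 2 ∧ narayanaWord (blockStart a) = 0) := by
        by_cases ha : narayanaWord a = 1
        · exact .inl ⟨narayanaWord_blockStart_eq_two ha,
            narayanaWord_blockStart_eq_zero (by omega)⟩
        · exact .inr ⟨narayanaWord_blockStart_eq_two (by omega),
            narayanaWord_blockStart_eq_zero ha⟩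
      rcases k with _ | k
      · left
        have : LcpAt (blockStart^[0 + 1] a) (blockStart^[0 + 1] b) 0 :=
          ⟨agreeAt_zero _ _, by simp only [Function.iterate_succ_apply, Function.iterate_zero_apply,
            zero_add, add_zero]; omega⟩
        have := this.le hrm
        omega
      · right
        refine ⟨k, ?_, ?_⟩
        · have : LcpAt (blockStart^[k + 2] a) (blockStart^[k + 2] b) (narayanaSum k) := by
            rw [Function.iterate_succ_apply, Function.iterate_succ_apply blockStart (k + 1)]
            rcases key with ⟨h2, h0⟩ | ⟨h2, h0⟩
            · exact lcpAt_narayanaSum k h2 h0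
            · exact (lcpAt_narayanaSum k h2 h0).symm
          have := this.le hrm
          omega
        · have : blockStart^[k + 1 + 1] a + narayana k ≤ blockStart^[k + 1 + 1] (a + 1) :=
            narayana_le a k
          omega

/-! ### Transfer to A202340 -/

/-- Each letter of `narayanaWord` is determined by two consecutive terms of A202340. -/
theorem narayanaWord_eq_of_A202340 {i j : ℕ} (h : A202340 i = A202340 j)
    (h' : A202340 (i + 1) = A202340 (j + 1)) : narayanaWord i = narayanaWord j := by
  have aux : ∀ n, narayanaWord n = if A202340 (n + 1) = 2 then 0 else
      if A202340 n = 2 then 1 else 2 := by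
    intro n
    rw [A202340_succ]
    rcases n with _ | n
    · simp [narayanaWord_zero]
    · rw [A202340_succ]
      rcases narayanaWord_cases (n + 1) with c | c | c
      · simp [c]
      · simp [c, narayanaWord_pred_of_eq_one c]
      · simp [c, narayanaWord_pred_of_eq_two c]
  rw [aux i, aux j, h, h']

theorem A202340_eq_of_narayanaWord {i j : ℕ} (h : narayanaWord i = narayanaWord j) :
    A202340 (i + 1) = A202340 (j + 1) := by
  rw [A202340_succ, A202340_succ, h]

/-- Needed for period 1 with overlap 2, which the bound `narayanaSum 0 + 1 = 2` does not exclude. -/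
theorem A202340_not_cube (i : ℕ) :
    ¬ (A202340 i = A202340 (i + 1) ∧ A202340 (i + 1) = A202340 (i + 2)) := by
  rintro ⟨h1, h2⟩
  rcases i with _ | i
  · rw [A202340_zero, A202340_succ, narayanaWord_zero] at h1
    simp at h1
  · have e1 := narayanaWord_eq_of_A202340 h1 h2
    rw [A202340_succ, A202340_succ] at h1
    have c := narayanaWord_cases (i + 1)
    rcases c with c | c | c
    -- In `000` the first letter would be the image of a `2`; the next block is then the image of a
    -- `0` and brings a `1`.
    · have e0 : narayanaWord i = 0 := by
        by_contra hc
        simp [c, hc] at h1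
      obtain ⟨n, hn⟩ := exists_blockStart_of_ne_one (n := i) (by omega)
      have c2 : narayanaWord (i + 2) = 0 := e1 ▸ c
      have n0 : narayanaWord n ≠ 0 := by
        intro hc
        have := narayanaWord_blockStart_add_one hc
        rw [← hn] at this
        omega
      have n2 : narayanaWord n = 2 := by
        have := narayanaWord_cases n
        by_contra hc
        have := narayanaWord_blockStart_eq_two (i := n) (by omega)
        rw [← hn] at this
        omega
      have := narayanaWord_blockStart_add_one (narayanaWord_succ_of_eq_two n2)
      rw [blockStart_succ_of_ne n0, ← hn] at this
      omega
    · have := narayanaWord_pred_of_eq_one (e1 ▸ c : narayanaWord (i + 1 + 1) = 1)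
      omega
    · have := narayanaWord_pred_of_eq_two (e1 ▸ c : narayanaWord (i + 1 + 1) = 2)
      omega

/-! ### Asymptotics of the Narayana sums -/

/-- Both sides grow by `3 * narayana (k + 2)` from `k` to `k + 2`, so the defect stays at its
initial value: 4 for even `k`, 5 for odd `k`. -/
theorem three_mul_narayanaSum (k : ℕ) :
    3 * narayanaSum k + 4 ≤ narayana (k + 2) + narayana (k + 1) + 2 * narayana k ∧
    narayana (k + 2) + narayana (k + 1) + 2 * narayana k ≤ 3 * narayanaSum k + 5 := by
  induction k using Nat.twoStepInduction with
  | zero =>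
    simp only [narayanaSum, zero_add, narayana_zero, narayana_one, narayana_two]
    omega
  | one =>
    have := narayana_add_three 0
    simp only [zero_add, narayana_zero, narayana_two] at this
    simp only [narayanaSum, Nat.reduceAdd, narayana_one, narayana_two, this]
    omega
  | more k ih _ =>
    have h1 := narayana_add_three k
    have h2 := narayana_add_three (k + 1)
    simp only [narayanaSum]
    simp only [add_assoc, Nat.reduceAdd] at *
    omega

/-- The deviation of `narayana` from a geometric progression of ratio `α`. -/
noncomputable def narayanaDeviation (α : ℝ) (k : ℕ) : ℝ := narayana (k + 1) - α * narayana k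

/-- A quadratic form in consecutive deviations that contracts in each step. -/
noncomputable def narayanaForm (α : ℝ) (k : ℕ) : ℝ :=
  narayanaDeviation α (k + 1) ^ 2
    + (α - 1) * narayanaDeviation α k * narayanaDeviation α (k + 1)
    + (α ^ 2 - α) * narayanaDeviation α k ^ 2

theorem narayanaDeviation_add_two {α : ℝ} (hα : α ^ 3 = α ^ 2 + 1) (k : ℕ) :
    narayanaDeviation α (k + 2) =
      -(α - 1) * narayanaDeviation α (k + 1) - (α ^ 2 - α) * narayanaDeviation α k := by
  simp only [narayanaDeviation, add_assoc, Nat.reduceAdd, narayana_add_three]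
  push_cast
  linear_combination (-(narayana k : ℝ)) * hα

/-- With `β` a complex root of `X ^ 2 + (α - 1) X + (α ^ 2 - α)`, the form is `|y - β x| ^ 2` for
consecutive deviations `x`, `y`, and each step multiplies it by `|β| ^ 2`. -/
theorem narayanaForm_succ {α : ℝ} (hα : α ^ 3 = α ^ 2 + 1) (k : ℕ) :
    narayanaForm α (k + 1) = (α ^ 2 - α) * narayanaForm α k := by
  simp only [narayanaForm, add_assoc, Nat.reduceAdd, narayanaDeviation_add_two hα]
  ring

theorem narayanaForm_nonneg {α : ℝ} (h1 : 1.4655 < α) (h2 : α < 1.4656) (k : ℕ) :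
    0 ≤ narayanaForm α k := by
  unfold narayanaForm
  generalize narayanaDeviation α k = x
  generalize narayanaDeviation α (k + 1) = y
  have : 0 ≤ (α ^ 2 - α - (α - 1) ^ 2 / 4) * x ^ 2 := by
    have : 0 ≤ α ^ 2 - α - (α - 1) ^ 2 / 4 := by nlinarith
    positivity
  nlinarith [sq_nonneg (y + (α - 1) / 2 * x)]

theorem narayanaForm_le {α : ℝ} (hα : α ^ 3 = α ^ 2 + 1) (h1 : 1.4655 < α) (h2 : α < 1.4656)
    (k : ℕ) : narayanaForm α (k + 2) ≤ 0.105 := by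
  induction k with
  | zero =>
    have e3 : narayana 3 = 4 := by
      rw [narayana_add_three 0, zero_add, narayana_two, narayana_zero]
    have e4 : narayana 4 = 6 := by
      rw [narayana_add_three 1, e3, narayana_one]
    simp only [narayanaForm, narayanaDeviation, zero_add, Nat.reduceAdd, e3, e4, narayana_two]
    push_cast
    have hα4 : α ^ 4 = α ^ 2 + 1 + α := by linear_combination (α + 1) * hα
    ring_nf
    rw [hα4, hα]
    nlinarith
  | succ k ih =>
    rw [show k + 1 + 2 = k + 2 + 1 from rfl, narayanaForm_succ hα]
    have := narayanaForm_nonneg h1 h2 (k + 2)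
    have : α ^ 2 - α ≤ 1 := by nlinarith
    nlinarith

theorem abs_narayanaDeviation_le {α : ℝ} (hα : α ^ 3 = α ^ 2 + 1) (h1 : 1.4655 < α)
    (h2 : α < 1.4656) (k : ℕ) :
    |narayanaDeviation α (k + 3) + (α + 1) * narayanaDeviation α (k + 2)| ≤ 1 := by
  have h := narayanaForm_le hα h1 h2 k
  unfold narayanaForm at h
  rw [← sq_le_one_iff_abs_le_one]
  simp only [add_assoc, Nat.reduceAdd] at h
  generalize narayanaDeviation α (k + 2) = x at *
  generalize narayanaDeviation α (k + 3) = y at *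
  -- Nine times the form dominates the square of `y + (α + 1) x`, by completing the square in `y`;
  -- and `9 * 0.105 < 1`.
  have a1 : 0 ≤ (9 * (α ^ 2 - α) - (α + 1) ^ 2 - (7 * α - 11) ^ 2 / 32) * x ^ 2 := by
    have : 0 ≤ 9 * (α ^ 2 - α) - (α + 1) ^ 2 - (7 * α - 11) ^ 2 / 32 := by nlinarith
    positivity
  nlinarith [sq_nonneg (y + (7 * α - 11) / 16 * x)]

/-- Here `narayana (k + 2) + narayana (k + 1) + 2 * narayana k` equals `(α ^ 2 + α + 2) * narayana
k` plus the combination of deviations bounded by 1, and the defect 4 leaves room for it. -/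
theorem narayanaSum_add_one_le {α : ℝ} (hα : α ^ 3 = α ^ 2 + 1) (h1 : 1.4655 < α)
    (h2 : α < 1.4656) (k : ℕ) :
    (narayanaSum (k + 1) : ℝ) + 1 ≤ (α ^ 2 + α + 2) / 3 * narayana (k + 1) := by
  rcases k with _ | k
  · simp only [narayanaSum, zero_add, narayana_one]
    push_cast
    nlinarith
  · have h := (three_mul_narayanaSum (k + 2)).1
    have h' := (abs_le.1 (abs_narayanaDeviation_le hα h1 h2 k)).2
    simp only [narayanaDeviation, add_assoc, Nat.reduceAdd] at h h' ⊢
    have h'' : 3 * (narayanaSum (k + 2) : ℝ) + 4 ≤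
      narayana (k + 4) + (narayana (k + 3) + 2 * narayana (k + 2)) := by exact_mod_cast h
    linarith

theorem le_narayanaSum_add {α : ℝ} (hα : α ^ 3 = α ^ 2 + 1) (h1 : 1.4655 < α)
    (h2 : α < 1.4656) (k : ℕ) :
    (α ^ 2 + α + 2) / 3 * narayana (k + 2) ≤ (narayanaSum (k + 2) : ℝ) + 2 := by
  have h := (three_mul_narayanaSum (k + 2)).2
  have h' := (abs_le.1 (abs_narayanaDeviation_le hα h1 h2 k)).1
  simp only [narayanaDeviation, add_assoc, Nat.reduceAdd] at h h' ⊢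
  have h'' : narayana (k + 4) + (narayana (k + 3) + 2 * narayana (k + 2)) ≤
    3 * (narayanaSum (k + 2) : ℝ) + 5 := by exact_mod_cast h
  linarith

/-! ### Exponents of factors of A202340 -/

theorem length_wordFactor {A : Type*} (w : ℕ → A) (i n : ℕ) : (wordFactor w i n).length = n := by
  simp [wordFactor]

theorem wordHasPeriod_wordFactor_iff {A : Type*} {w : ℕ → A} {i n p : ℕ} :
    WordHasPeriod (wordFactor w i n) p ↔
      1 ≤ p ∧ p ≤ n ∧ ∀ t, t + p < n → w (i + t) = w (i + t + p) := by
  rw [WordHasPeriod, length_wordFactor]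
  refine and_congr_right fun _ => and_congr_right fun hp => ?_
  rw [List.hasPeriod_iff_getElem?]
  simp only [length_wordFactor]
  refine forall_congr' fun t => ?_
  constructor
  · intro h ht
    have := h (by omega)
    simpa [wordFactor, ht, (by omega : t < n), add_assoc] using this
  · intro h ht
    have := h (by omega)
    simpa [wordFactor, (by omega : t + p < n), (by omega : t < n), add_assoc] using this

theorem wordHasPeriod_wordPeriod {A : Type*} {u : List A} (hu : 1 ≤ u.length) :
    WordHasPeriod u (wordPeriod u) :=
  Nat.sInf_mem (s := {p | WordHasPeriod u p}) ⟨u.length, hu, le_rfl, by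
    simp [List.HasPeriod]⟩

theorem wordExponent_A202340_le {α : ℝ} (hα : α ^ 3 = α ^ 2 + 1) (h1 : 1.4655 < α)
    (h2 : α < 1.4656) {i n : ℕ} (hn : 1 ≤ n) :
    wordExponent (wordFactor A202340 i n) ≤ (α ^ 2 + α + 5) / 3 := by
  have hp := wordHasPeriod_wordPeriod (u := wordFactor A202340 i n)
    (by rwa [length_wordFactor])
  unfold wordExponent
  rw [length_wordFactor]
  generalize wordPeriod (wordFactor A202340 i n) = p at *
  obtain ⟨p1, pn, hp⟩ := wordHasPeriod_wordFactor_iff.1 hp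
  have p1' : (1 : ℝ) ≤ p := by exact_mod_cast p1
  rw [div_le_iff₀ (by linarith)]
  obtain ⟨m, rfl⟩ := Nat.exists_eq_add_of_le pn
  suffices h : (m : ℝ) ≤ (α ^ 2 + α + 2) / 3 * p by
    push_cast
    linarith
  have hc : 1.8 ≤ (α ^ 2 + α + 2) / 3 := by nlinarith
  -- One letter is lost because each letter of `narayanaWord` is read from two consecutive terms.
  have hagree : AgreeAt i (i + p) (m - 1) := by
    intro t ht
    apply narayanaWord_eq_of_A202340
    · have := hp t (by omega)
      rwa [add_right_comm i p t]
    · have := hp (t + 1) (by omega)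
      rwa [show i + p + t + 1 = i + (t + 1) + p by omega]
  have small : m ≤ 1 → (m : ℝ) ≤ (α ^ 2 + α + 2) / 3 * p := fun hm => by
    have : (m : ℝ) ≤ 1 := by exact_mod_cast hm
    nlinarith
  rcases hagree.exists_le_narayanaSum (by omega) with hm | ⟨k, hm, hk⟩
  · exact small (by omega)
  · rw [Nat.add_sub_cancel_left] at hk
    rcases k with _ | k
    · by_cases hm1 : m ≤ 1
      · exact small hm1
      · have hp2 : p ≠ 1 := by
          rintro rfl
          exact A202340_not_cube i ⟨hp 0 (by omega), hp 1 (by omega)⟩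
        have hm' : (m : ℝ) ≤ 2 := by
          simp only [narayanaSum] at hm
          exact_mod_cast (by omega : m ≤ 2)
        have hp' : (2 : ℝ) ≤ p := by exact_mod_cast (by omega : 2 ≤ p)
        nlinarith
    · have h := narayanaSum_add_one_le hα h1 h2 k
      have hm' : (m : ℝ) ≤ narayanaSum (k + 1) + 1 := by
        exact_mod_cast (by omega : m ≤ narayanaSum (k + 1) + 1)
      have hk' : (narayana (k + 1) : ℝ) ≤ p := by exact_mod_cast hk
      nlinarith

theorem le_wordExponent_A202340 (k : ℕ) :
    ∃ i, ((narayana k + narayanaSum k : ℕ) : ℝ) / narayana k ≤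
      wordExponent (wordFactor A202340 i (narayana k + narayanaSum k)) := by
  have hN := narayana_pos k
  -- Positions 2 and 3 carry `2` and `0`, and their images start `narayana k` apart; the `+ 1` is
  -- the shift between A202340 and `narayanaWord`.
  refine ⟨blockStart^[k + 1] 2 + 1, ?_⟩
  have hper : WordHasPeriod (wordFactor A202340 (blockStart^[k + 1] 2 + 1)
      (narayana k + narayanaSum k)) (narayana k) := by
    rw [wordHasPeriod_wordFactor_iff]
    refine ⟨hN, by omega, fun t ht => ?_⟩
    have h := (lcpAt_narayanaSum k narayanaWord_two narayanaWord_three).1 t (by omega)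
    rw [show 3 = 2 + 1 from rfl, iterate_blockStart_succ_of_eq_two narayanaWord_two] at h
    have := A202340_eq_of_narayanaWord h
    rwa [add_right_comm, add_right_comm _ 1 t, add_right_comm _ (narayana k) t,
      add_right_comm _ (narayana k) 1] at *
  unfold wordExponent
  rw [length_wordFactor]
  have hle : wordPeriod (wordFactor A202340 (blockStart^[k + 1] 2 + 1)
      (narayana k + narayanaSum k)) ≤ narayana k := Nat.sInf_le hper
  have hpos := (wordHasPeriod_wordPeriod (u := wordFactor A202340 (blockStart^[k + 1] 2 + 1)
      (narayana k + narayanaSum k)) (by rw [length_wordFactor]; omega)).1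
  gcongr

theorem isCriticalExponent_A202340 {α : ℝ} (hα : α ^ 3 = α ^ 2 + 1) (h1 : 1.4655 < α)
    (h2 : α < 1.4656) : IsCriticalExponent A202340 ((α ^ 2 + α + 5) / 3) := by
  constructor
  · rintro e ⟨i, n, hn, rfl⟩
    exact wordExponent_A202340_le hα h1 h2 hn
  · intro b hb
    by_contra! hlt
    -- These factors miss the claimed value by at most `2 / narayana (k + 2)`.
    obtain ⟨k, hk⟩ := exists_nat_gt (2 / ((α ^ 2 + α + 5) / 3 - b))
    rw [div_lt_iff₀ (by linarith)] at hk
    obtain ⟨i, hi⟩ := le_wordExponent_A202340 (k + 2)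
    have hN := narayana_pos (k + 2)
    have hb' := hi.trans (hb ⟨i, _, by omega, rfl⟩)
    have hkN : (k : ℝ) ≤ narayana (k + 2) := by
      exact_mod_cast (Nat.le_add_right k 2).trans narayana_strictMono.le_apply
    have hN' : (0 : ℝ) < narayana (k + 2) := by exact_mod_cast hN
    rw [div_le_iff₀ hN'] at hb'
    have h := le_narayanaSum_add hα h1 h2 k
    push_cast at hb'
    nlinarith

/-! ### The real root and its numerical value -/

theorem exists_root_near : ∃ α : ℝ, α ^ 3 = α ^ 2 + 1 ∧
    1.46557123187676802665673122 < α ∧ α < 1.46557123187676802665673123 := by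
  have hf : ContinuousOn (fun x : ℝ => x ^ 3 - x ^ 2 - 1)
      (Set.Icc 1.46557123187676802665673122 1.46557123187676802665673123) := by fun_prop
  obtain ⟨α, ⟨ha, hb⟩, h⟩ := intermediate_value_Ioo (by norm_num) hf
    (show (0 : ℝ) ∈ Set.Ioo _ _ by constructor <;> norm_num)
  exact ⟨α, by linarith [h], ha, hb⟩

theorem eq_of_cube_eq {α x : ℝ} (hα : α ^ 3 = α ^ 2 + 1) (h1 : 1.4655 < α)
    (hx : x ^ 3 = x ^ 2 + 1) : x = α := by
  -- The quadratic cofactor has negative discriminant since `α > 1`.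
  have h : (x - α) * (x ^ 2 + (α - 1) * x + (α ^ 2 - α)) = 0 := by
    linear_combination hx - hα
  rcases mul_eq_zero.1 h with h | h
  · linarith
  · nlinarith [sq_nonneg (x + (α - 1) / 2)]

theorem theorem39 :
    ∃ α : ℝ, (α ^ 3 = α ^ 2 + 1 ∧ ∀ x : ℝ, x ^ 3 = x ^ 2 + 1 → x = α) ∧
      |α - 1.465571231876768026656731| < 1 / 10 ^ 24 ∧
      IsCriticalExponent A202340 ((α ^ 2 + α + 5) / 3) ∧
      |(α ^ 2 + α + 5) / 3 - 2.871156755860518460227649| < 1 / 10 ^ 24 := by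
  obtain ⟨α, hα, h1, h2⟩ := exists_root_near
  have h1' : 1.4655 < α := by linarith
  refine ⟨α, ⟨hα, fun x hx => eq_of_cube_eq hα h1' hx⟩, ?_,
    isCriticalExponent_A202340 hα h1' (by linarith), ?_⟩
  · rw [abs_lt]
    constructor <;> linarith
  · rw [abs_lt]
    constructor <;> nlinarith
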